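/- Let $\mathrm{Aut}(\mathbb{Q})$ be the group (under composition) of order automorphisms of the countable dense linear order without endpoints $(\mathbb{Q},\le)$, and let $\mathrm{Aut}(\mathrm{Aut}(\mathbb{Q}))$ be the group of all automorphisms of the abstract group $\mathrm{Aut}(\mathbb{Q})$. Let $\nu \in \mathrm{Aut}(\mathrm{Aut}(\mathbb{Q}))$ be conjugation by the permutation $q \mapsto -q$ of $\mathbb{Q}$, i.e. $\nu(g)(q) = -g(-q)$; it satisfies $\nu^2 = 1$. Then $$\mathrm{Aut}(\mathrm{Aut}(\mathbb{Q})) \cong \mathrm{Aut}(\mathbb{Q}) \rtimes \mathbb{Z}_2,$$ where the nontrivial element of $\mathbb{Z}_2$ acts on $\mathrm{Aut}(\mathbb{Q})$ by $\nu$. More precisely, there is a group isomorphism $e : \mathrm{Aut}(\mathbb{Q}) \rtimes \mathbb{Z}_2 \to \mathrm{Aut}(\mathrm{Aut}(\mathbb{Q}))$ that sends each $g \in \mathrm{Aut}(\mathbb{Q})$ to the inner automorphism $h \mapsto g h g^{-1}$ and sends the nontrivial element of $\mathbb{Z}_2$ to $\nu$. -/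

import Mathlib

/-- Conjugation of an order automorphism `g` of `ℚ` by the order-reversing
permutation `q ↦ -q`, that is, `q ↦ -g (-q)`. It is again an order automorphism. -/
def negConjFun (g : ℚ ≃o ℚ) : ℚ ≃o ℚ where
  toFun q := -g (-q)
  invFun q := -g.symm (-q)
  left_inv q := by simp
  right_inv q := by simp
  map_rel_iff' := by
    intro a b
    simp

/-- Conjugation by `q ↦ -q`, as an automorphism of the group `Aut(ℚ, ≤)`
(the group operation on `ℚ ≃o ℚ` is composition). -/
def negConj : MulAut (ℚ ≃o ℚ) where
  toFun := negConjFun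
  invFun := negConjFun
  left_inv g := by
    ext q
    simp [negConjFun]
  right_inv g := by
    ext q
    simp [negConjFun]
  map_mul' g h := by
    ext q
    simp [negConjFun]

theorem negConj_apply (g : ℚ ≃o ℚ) (q : ℚ) : negConj g q = -g (-q) := rfl

theorem negConj_mul_negConj : negConj * negConj = 1 := by
  ext g q
  simp [negConj_apply]

/-- The action of `ℤ/2` (written multiplicatively) on `Aut(ℚ, ≤)` in which the
nontrivial element acts as conjugation by `q ↦ -q`. -/
def negAction : Multiplicative (ZMod 2) →* MulAut (ℚ ≃o ℚ) where
  toFun z := if z = 1 then 1 else negConj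
  map_one' := by simp
  map_mul' z w := by
    have key : ∀ z : Multiplicative (ZMod 2), z = 1 ∨ z = Multiplicative.ofAdd 1 := by decide
    have hne : (Multiplicative.ofAdd (1 : ZMod 2)) ≠ 1 := by decide
    have hsq : (Multiplicative.ofAdd (1 : ZMod 2)) * Multiplicative.ofAdd 1 = 1 := by decide
    rcases key z with rfl | rfl <;> rcases key w with rfl | rfl <;>
      simp only [mul_one, one_mul, hsq, hne, if_true, if_false, negConj_mul_negConj]

/-!
Every automorphism `φ` of `Aut(ℚ)` is conjugation by a permutation of `ℚ` that preserves or
reverses the order. The point is that `φ` permutes the point stabilizers, and this is proved with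
the topology of pointwise convergence, for which `Aut(ℚ)` is a Polish group.

The stabilizer of `q` is the product of two subgroups with trivial intersection, each the
centralizer of a set: the automorphisms supported to the left and to the right of `q` centralize
each other (`coe_stabilizer_eq_mul`, `disjoint_centralizer_fixingSubgroup`). This description is
purely algebraic, so the preimage `H` of the stabilizer under `φ` has it too. Centralizers are
closed, so `H` is an injective continuous image of a closed set, hence Borel by the Lusin–Souslin
theorem. It has countable index, hence is not meagre, and Pettis' argument shows that it is open
(`Subgroup.isOpen_of_eq_mul_of_isClosed`).

A proper open subgroup fixes a point (`exists_le_stabilizer_of_fixingSubgroup_le`): it contains the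
pointwise stabilizer of a finite set `F`, points of `F` that it moves off `F` can be dropped from
`F`, and a nonempty finite set that is preserved by an order automorphism has its least element
fixed. As point stabilizers are maximal subgroups (`isCoatom_stabilizer`), `H` is one of them.

This gives a permutation `σ` of `ℚ` with `φ g (σ q) = σ (g q)` (`exists_perm_conj`). As `Aut(ℚ)` is
transitive on pairs `x < y`, the order of `σ 0` and `σ 1` decides that of all pairs, so `σ` is
strictly monotone or strictly antitone. In the first case `φ` is inner, in the second it is an
inner automorphism times `negConj`. The two cases exclude each other and the centre is trivial, so
the map from the semidirect product is bijective.
-/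

open Topology Pointwise MulAction

/-! ### Open subgroups of Polish groups -/

/-- A Borel subgroup of countable index in a Baire group is open. -/
theorem Subgroup.isOpen_of_countable_quotient_of_measurableSet {G : Type*} [Group G]
    [TopologicalSpace G] [IsTopologicalGroup G] [BaireSpace G] [MeasurableSpace G] [BorelSpace G]
    (H : Subgroup G) [Countable (G ⧸ H)] (hH : MeasurableSet (H : Set G)) :
    IsOpen (H : Set G) := by
  obtain ⟨U, hU, hHU⟩ := hH.residualEq_isOpen
  have translate (g : G) {s t : Set G} (h : s =ᵇ t) :
      (fun x => g⁻¹ * x) ⁻¹' s =ᵇ (fun x => g⁻¹ * x) ⁻¹' t :=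
    h.comp_tendsto (tendsto_residual_of_isOpenMap (Homeomorph.mulLeft g⁻¹).continuous
      (Homeomorph.mulLeft g⁻¹).isOpenMap)
  -- Were `U` empty, the countably many cosets of `H` would be meagre sets covering `G`.
  have hne : U.Nonempty := by
    by_contra hU0
    rw [Set.not_nonempty_iff_eq_empty] at hU0
    subst hU0
    have meagre : ∀ g : G, IsMeagre ((fun x => g⁻¹ * x) ⁻¹' (H : Set G)) := fun g => by
      have := translate g hHU
      rw [Set.preimage_empty, Filter.eventuallyEq_empty] at this
      exact this
    have hcover : (⋃ c : G ⧸ H, (fun x => c.out⁻¹ * x) ⁻¹' (H : Set G)) = Set.univ := by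
      refine Set.eq_univ_of_forall fun x => Set.mem_iUnion.2 ⟨(x : G ⧸ H), ?_⟩
      exact QuotientGroup.eq.1 (QuotientGroup.out_eq' (x : G ⧸ H))
    exact not_isMeagre_of_isOpen isOpen_univ ⟨1, trivial⟩
      (hcover ▸ isMeagre_iUnion fun c : G ⧸ H => meagre c.out)
  obtain ⟨u, hu⟩ := hne
  have hnhds : (fun g => g⁻¹ * u) ⁻¹' U ∈ 𝓝 (1 : G) :=
    (hU.preimage (by fun_prop)).mem_nhds (by simpa using hu)
  refine H.isOpen_of_mem_nhds (Filter.mem_of_superset hnhds fun g hg => ?_)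
  -- For `g` near `1` the open set `g U ∩ U` is nonempty, so `g H` meets `H`.
  have hI : ((fun x => g⁻¹ * x) ⁻¹' (H : Set G) ∩ (H : Set G) : Set G) =ᵇ
      ((fun x => g⁻¹ * x) ⁻¹' U ∩ U : Set G) :=
    (translate g hHU).inter hHU
  have hopen : IsOpen ((fun x => g⁻¹ * x) ⁻¹' U ∩ U) := (hU.preimage (by fun_prop)).inter hU
  have hnon : ((fun x => g⁻¹ * x) ⁻¹' (H : Set G) ∩ (H : Set G)).Nonempty := by
    by_contra h0
    rw [Set.not_nonempty_iff_eq_empty] at h0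
    rw [h0] at hI
    exact not_isMeagre_of_isOpen hopen ⟨u, hg, hu⟩ (Filter.eventuallyEq_empty.1 hI.symm)
  obtain ⟨x, hx, hx'⟩ := hnon
  have : x * (g⁻¹ * x)⁻¹ ∈ H := H.mul_mem hx' (H.inv_mem hx)
  simpa using this

/-- In a Polish group, a subgroup of countable index that is the product of two closed subgroups
with trivial intersection is open: multiplication is injective on `A × B`, so `A * B` is Borel. -/
theorem Subgroup.isOpen_of_eq_mul_of_isClosed {G : Type*} [Group G] [TopologicalSpace G]
    [IsTopologicalGroup G] [PolishSpace G] {A B H : Subgroup G} [Countable (G ⧸ H)]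
    (hA : IsClosed (A : Set G)) (hB : IsClosed (B : Set G)) (hAB : Disjoint A B)
    (hH : (H : Set G) = A * B) : IsOpen (H : Set G) := by
  borelize G
  refine H.isOpen_of_countable_quotient_of_measurableSet ?_
  rw [hH, ← Set.image_mul_prod]
  exact (hA.measurableSet.prod hB.measurableSet).image_of_continuousOn_injOn
    continuous_mul.continuousOn fun p hp q hq h => by
      have h' : q.1⁻¹ * p.1 = q.2 * p.2⁻¹ := by
        rw [inv_mul_eq_iff_eq_mul, ← mul_assoc, eq_mul_inv_iff_mul_eq]; exact h
      have h1 : q.1⁻¹ * p.1 = 1 := by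
        have hmem : q.1⁻¹ * p.1 ∈ A := A.mul_mem (A.inv_mem hq.1) hp.1
        exact (Subgroup.disjoint_def.1 hAB) hmem (h' ▸ B.mul_mem hq.2 (B.inv_mem hp.2))
      have e1 : p.1 = q.1 := (inv_mul_eq_one.1 h1).symm
      exact Prod.ext e1 (mul_inv_eq_one.1 (h' ▸ h1)).symm

/-! ### Constructing order automorphisms of `ℚ` -/

/-- The piecewise linear map of `ℚ` that is the identity off `(a, b)` and sends `x` to `y`, for
`x` and `y` in `(a, b)`. -/
def bendFun (a b x y t : ℚ) : ℚ :=
  if t ≤ a then t else if t ≤ x then a + (t - a) * ((y - a) / (x - a))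
  else if t ≤ b then b - (b - t) * ((b - y) / (b - x)) else t

theorem bendFun_bendFun {a b x y : ℚ} (hax : a < x) (hxb : x < b) (hay : a < y) (hyb : y < b)
    (t : ℚ) : bendFun a b y x (bendFun a b x y t) = t := by
  have h1 : 0 < x - a := sub_pos.2 hax
  have h2 : 0 < y - a := sub_pos.2 hay
  have h3 : 0 < b - x := sub_pos.2 hxb
  have h4 : 0 < b - y := sub_pos.2 hyb
  have e1 : (y - a) / (x - a) * ((x - a) / (y - a)) = 1 := by field_simp
  have e2 : (b - y) / (b - x) * ((b - x) / (b - y)) = 1 := by field_simp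
  have p1 : 0 < (y - a) / (x - a) := div_pos h2 h1
  have p2 : 0 < (b - y) / (b - x) := div_pos h4 h3
  have q1 : (x - a) * ((y - a) / (x - a)) = y - a := by field_simp
  have q2 : (b - x) * ((b - y) / (b - x)) = b - y := by field_simp
  unfold bendFun
  generalize (y - a) / (x - a) = r at *
  generalize (b - y) / (b - x) = s at *
  rcases le_or_gt t a with ha | ha
  · simp [ha]
  rcases le_or_gt t x with hx | hx
  · have m1 : 0 < (t - a) * r := mul_pos (sub_pos.2 ha) p1
    have m2 : (t - a) * r ≤ y - a := q1 ▸ mul_le_mul_of_nonneg_right (by linarith) p1.le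
    rw [if_neg ha.not_ge, if_pos hx, if_neg (by linarith), if_pos (by linarith),
      add_sub_cancel_left, mul_assoc, e1]
    ring
  rcases le_or_gt t b with hb | hb
  · have m1 : 0 ≤ (b - t) * s := mul_nonneg (sub_nonneg.2 hb) p2.le
    have m2 : (b - t) * s < b - y := q2 ▸ mul_lt_mul_of_pos_right (by linarith) p2
    rw [if_neg ha.not_ge, if_neg hx.not_ge, if_pos hb, if_neg (by linarith), if_neg (by linarith),
      if_pos (by linarith), sub_sub_cancel, mul_assoc, e2]
    ring
  · rw [if_neg ha.not_ge, if_neg hx.not_ge, if_neg hb.not_ge, if_neg ha.not_ge,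
      if_neg (by linarith), if_neg hb.not_ge]

theorem monotone_bendFun {a b x y : ℚ} (hax : a < x) (hxb : x < b) (hay : a < y) (hyb : y < b) :
    Monotone (bendFun a b x y) := by
  have h1 : 0 < x - a := sub_pos.2 hax
  have h2 : 0 < y - a := sub_pos.2 hay
  have h3 : 0 < b - x := sub_pos.2 hxb
  have h4 : 0 < b - y := sub_pos.2 hyb
  have p1 : 0 < (y - a) / (x - a) := div_pos h2 h1
  have p2 : 0 < (b - y) / (b - x) := div_pos h4 h3
  have q1 : (x - a) * ((y - a) / (x - a)) = y - a := by field_simp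
  have q2 : (b - x) * ((b - y) / (b - x)) = b - y := by field_simp
  unfold bendFun
  generalize (y - a) / (x - a) = r at *
  generalize (b - y) / (b - x) = s at *
  intro t u htu
  dsimp only
  split_ifs <;> nlinarith

theorem OrderIso.exists_apply_eq_of_Ioo {a b x y : ℚ} (hx : x ∈ Set.Ioo a b)
    (hy : y ∈ Set.Ioo a b) : ∃ g : ℚ ≃o ℚ, g x = y ∧ ∀ t ∉ Set.Ioo a b, g t = t := by
  have hmono := (monotone_bendFun hx.1 hx.2 hy.1 hy.2)
  have hinv := bendFun_bendFun hx.1 hx.2 hy.1 hy.2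
  refine ⟨StrictMono.orderIsoOfRightInverse (bendFun a b x y)
    (hmono.strictMono_of_injective (Function.LeftInverse.injective hinv)) (bendFun a b y x)
    (bendFun_bendFun hy.1 hy.2 hx.1 hx.2), ?_, fun t ht => ?_⟩
  · have : x - a ≠ 0 := (sub_pos.2 hx.1).ne'
    change bendFun a b x y x = y
    rw [bendFun, if_neg hx.1.not_ge, if_pos le_rfl]
    field_simp
    ring
  · change bendFun a b x y t = t
    rw [bendFun]
    rcases le_or_gt t a with ha | ha
    · simp [ha]
    · have hb : b ≤ t := not_lt.1 fun h => ht ⟨ha, h⟩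
      rw [if_neg ha.not_ge, if_neg (hx.2.trans_le hb).not_ge]
      split_ifs with h
      · rw [le_antisymm h hb]; simp
      · rfl

theorem OrderIso.exists_apply_ne {a b x : ℚ} (hx : x ∈ Set.Ioo a b) :
    ∃ g : ℚ ≃o ℚ, g x ≠ x ∧ ∀ t ∉ Set.Ioo a b, g t = t := by
  obtain ⟨y, hxy, hyb⟩ := exists_between hx.2
  obtain ⟨g, hg, hfix⟩ := OrderIso.exists_apply_eq_of_Ioo hx ⟨hx.1.trans hxy, hyb⟩
  exact ⟨g, hg ▸ hxy.ne', hfix⟩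

/-- `Aut(ℚ)` is transitive on the pairs `x < y`. -/
theorem OrderIso.exists_apply_eq_apply_eq {x y u v : ℚ} (hxy : x < y) (huv : u < v) :
    ∃ g : ℚ ≃o ℚ, g x = u ∧ g y = v := by
  have h : 0 < (v - u) / (y - x) := div_pos (sub_pos.2 huv) (sub_pos.2 hxy)
  have h' : y - x ≠ 0 := (sub_pos.2 hxy).ne'
  refine ⟨((OrderIso.addRight (-x)).trans (OrderIso.mulRight₀ _ h)).trans (OrderIso.addRight u),
    ?_, ?_⟩
  · simp
  · simp only [OrderIso.trans_apply, OrderIso.addRight_apply, OrderIso.mulRight₀_apply]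
    field_simp
    ring

/-- The order automorphism that agrees with `g` on `(-∞, q]` and is the identity on `[q, ∞)`, for
`g` fixing `q`. -/
def OrderIso.restrictIic {α : Type*} [LinearOrder α] (g : α ≃o α) {q : α} (hg : g q = q) :
    α ≃o α :=
  have hle : ∀ x, g x ≤ q ↔ x ≤ q := fun x => by rw [← g.le_iff_le (x := x), hg]
  StrictMono.orderIsoOfRightInverse (fun x => if x ≤ q then g x else x)
    (fun x y hxy => by
      dsimp only
      split_ifs with hx hy hy
      · exact g.strictMono hxy
      · exact ((hle x).2 hx).trans_lt (not_le.1 hy)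
      · exact absurd (hxy.le.trans hy) hx
      · exact hxy)
    (fun x => if x ≤ q then g.symm x else x)
    (fun x => by
      by_cases hx : x ≤ q
      · have : g.symm x ≤ q := (hle _).1 (by simpa using hx)
        simp [hx, this]
      · simp [hx])

theorem OrderIso.restrictIic_apply {α : Type*} [LinearOrder α] (g : α ≃o α) {q : α}
    (hg : g q = q) (x : α) : g.restrictIic hg x = if x ≤ q then g x else x := rfl

/-! ### The Polish topology of `Aut(ℚ)` -/

/-- An order automorphism of `ℚ` together with its inverse, as sequences of natural numbers through
an enumeration of `ℚ`. The enumeration replaces the metric topology of `ℚ` by the discrete one, and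
recording the inverse makes the range closed. -/
def autCode (g : ℚ ≃o ℚ) : (ℚ → ℕ) × (ℚ → ℕ) :=
  (fun q => Denumerable.eqv ℚ (g q), fun q => Denumerable.eqv ℚ (g.symm q))

/-- The topology of pointwise convergence on `Aut(ℚ)`, where `ℚ` is discrete. -/
instance : TopologicalSpace (ℚ ≃o ℚ) := TopologicalSpace.induced autCode inferInstance

theorem isOpen_setOf_apply_eq (p q : ℚ) : IsOpen {g : ℚ ≃o ℚ | g p = q} := by
  have h : IsOpen ((fun w : (ℚ → ℕ) × (ℚ → ℕ) => w.1 p) ⁻¹' {Denumerable.eqv ℚ q}) :=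
    (isOpen_discrete _).preimage (by fun_prop)
  have hset : {g : ℚ ≃o ℚ | g p = q} = autCode ⁻¹'
      ((fun w : (ℚ → ℕ) × (ℚ → ℕ) => w.1 p) ⁻¹' {Denumerable.eqv ℚ q}) :=
    Set.ext fun g => (Denumerable.eqv ℚ).apply_eq_iff_eq.symm
  exact hset ▸ h.preimage continuous_induced_dom

theorem continuous_of_isOpen_setOf_apply_eq {X : Type*} [TopologicalSpace X] {f : X → (ℚ ≃o ℚ)}
    (hf : ∀ p q, IsOpen {x | f x p = q}) : Continuous f := by
  refine continuous_induced_rng.2 (Continuous.prodMk (continuous_pi fun p => ?_)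
    (continuous_pi fun p => ?_))
  · refine continuous_discrete_rng.2 fun n => ?_
    convert hf p ((Denumerable.eqv ℚ).symm n) using 1
    ext x
    simp [Equiv.eq_symm_apply]
  · refine continuous_discrete_rng.2 fun n => ?_
    convert hf ((Denumerable.eqv ℚ).symm n) p using 1
    ext x
    change _ = n ↔ _
    rw [← Equiv.eq_symm_apply, OrderIso.symm_apply_eq]
    exact eq_comm

instance : IsTopologicalGroup (ℚ ≃o ℚ) where
  continuous_mul := continuous_of_isOpen_setOf_apply_eq fun p q => by
    have : {x : (ℚ ≃o ℚ) × (ℚ ≃o ℚ) | (x.1 * x.2) p = q} =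
        ⋃ r, {g | g r = q} ×ˢ {h | h p = r} := by
      ext x
      simp [RelIso.mul_apply]
    rw [this]
    exact isOpen_iUnion fun r => (isOpen_setOf_apply_eq r q).prod (isOpen_setOf_apply_eq p r)
  continuous_inv := continuous_of_isOpen_setOf_apply_eq fun p q => by
    convert isOpen_setOf_apply_eq q p using 1
    ext g
    exact (OrderIso.symm_apply_eq g).trans eq_comm

theorem isClosedEmbedding_autCode : IsClosedEmbedding autCode where
  eq_induced := rfl
  injective g h hgh := by
    ext q
    exact (Denumerable.eqv ℚ).injective (congrFun (congrArg Prod.fst hgh) q)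
  isClosed_range := by
    let e := Denumerable.eqv ℚ
    have hrange : Set.range autCode =
        (⋂ p, ⋂ q, {w | w.1 p = e q ↔ w.2 q = e p}) ∩
        ⋂ p, ⋂ q, {w | p ≤ q → e.symm (w.1 p) ≤ e.symm (w.1 q)} := by
      ext w
      simp only [Set.mem_inter_iff, Set.mem_iInter, Set.mem_ofPred_eq]
      constructor
      · rintro ⟨g, rfl⟩
        refine ⟨fun p q => ?_, fun p q hpq => ?_⟩
        · refine e.apply_eq_iff_eq.trans (Iff.trans ?_ e.apply_eq_iff_eq.symm)
          rw [OrderIso.symm_apply_eq]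
          exact eq_comm
        · simpa [autCode, e] using hpq
      · rintro ⟨hinv, hmono⟩
        have hl : ∀ p, e.symm (w.2 (e.symm (w.1 p))) = p := fun p => by
          rw [e.symm_apply_eq, ← hinv, e.apply_symm_apply]
        have hr : ∀ p, e.symm (w.1 (e.symm (w.2 p))) = p := fun p => by
          rw [e.symm_apply_eq, hinv, e.apply_symm_apply]
        have hm : Monotone fun p => e.symm (w.1 p) := fun p q => hmono p q
        refine ⟨StrictMono.orderIsoOfRightInverse _
          (hm.strictMono_of_injective (Function.LeftInverse.injective
            (g := fun p => e.symm (w.2 p)) hl)) _ hr, ?_⟩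
        refine Prod.ext (funext fun p => ?_) (funext fun p => ?_)
        · exact e.apply_symm_apply _
        · exact e.apply_symm_apply _
    rw [hrange]
    refine .inter (isClosed_iInter fun p => isClosed_iInter fun q => ?_)
      (isClosed_iInter fun p => isClosed_iInter fun q => ?_)
    · exact (isClosed_discrete {z : ℕ × ℕ | z.1 = e q ↔ z.2 = e p}).preimage
        (f := fun w : (ℚ → ℕ) × (ℚ → ℕ) => (w.1 p, w.2 q)) (by fun_prop)
    · exact (isClosed_discrete {z : ℕ × ℕ | p ≤ q → e.symm z.1 ≤ e.symm z.2}).preimage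
        (f := fun w : (ℚ → ℕ) × (ℚ → ℕ) => (w.1 p, w.1 q)) (by fun_prop)

instance : PolishSpace (ℚ ≃o ℚ) := isClosedEmbedding_autCode.polishSpace

/-- Every neighbourhood of `1` contains the pointwise stabilizer of a finite set. -/
theorem exists_finset_fixing_subset_of_mem_nhds {s : Set (ℚ ≃o ℚ)} (hs : s ∈ 𝓝 1) :
    ∃ F : Finset ℚ, ∀ g : ℚ ≃o ℚ, (∀ q ∈ F, g q = q) → g ∈ s := by
  have hle : 𝓝 (1 : ℚ ≃o ℚ) = (𝓝 (autCode 1)).comap autCode := nhds_induced _ _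
  rw [hle, Filter.mem_comap] at hs
  obtain ⟨t, ht, hts⟩ := hs
  rw [nhds_prod_eq, Filter.mem_prod_iff] at ht
  obtain ⟨u, hu, v, hv, huv⟩ := ht
  rw [nhds_pi, Filter.mem_pi'] at hu hv
  obtain ⟨I, U, hU, hIU⟩ := hu
  obtain ⟨J, V, hV, hJV⟩ := hv
  refine ⟨I ∪ J, fun g hg => hts (huv ⟨hIU fun q hq => ?_, hJV fun q hq => ?_⟩)⟩
  · have : (autCode g).1 q = (autCode 1).1 q := by
      simp [autCode, hg q (Finset.mem_union_left _ hq)]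
    rw [this]
    exact mem_of_mem_nhds (hU q)
  · have : (autCode g).2 q = (autCode 1).2 q := by
      have hq' : g.symm q = q := by
        rw [OrderIso.symm_apply_eq, hg q (Finset.mem_union_right _ hq)]
      simp only [autCode, hq']
      rfl
    rw [this]
    exact mem_of_mem_nhds (hV q)

/-! ### Point stabilizers are maximal -/

theorem eq_of_stabilizer_le {x y : ℚ} (h : stabilizer (ℚ ≃o ℚ) x ≤ stabilizer (ℚ ≃o ℚ) y) :
    x = y := by
  by_contra hne
  obtain ⟨a, b, hy, hx⟩ : ∃ a b, y ∈ Set.Ioo a b ∧ x ∉ Set.Ioo a b := by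
    rcases lt_or_gt_of_ne hne with hxy | hyx
    · exact ⟨x, y + 1, ⟨hxy, lt_add_one y⟩, fun h => lt_irrefl _ h.1⟩
    · exact ⟨y - 1, x, ⟨sub_one_lt y, hyx⟩, fun h => lt_irrefl _ h.2⟩
  obtain ⟨g, hgy, hg⟩ := OrderIso.exists_apply_ne hy
  exact hgy (h (hg x hx))

theorem stabilizer_ne_top (q : ℚ) : stabilizer (ℚ ≃o ℚ) q ≠ ⊤ := fun h =>
  zero_ne_one (α := ℚ) <|
    (eq_of_stabilizer_le (h ▸ le_top : stabilizer (ℚ ≃o ℚ) (0 : ℚ) ≤ stabilizer (ℚ ≃o ℚ) q)).trans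
    (eq_of_stabilizer_le (h ▸ le_top : stabilizer (ℚ ≃o ℚ) (1 : ℚ) ≤ stabilizer (ℚ ≃o ℚ) q)).symm

theorem isCoatom_stabilizer (q : ℚ) : IsCoatom (stabilizer (ℚ ≃o ℚ) q) := by
  refine ⟨stabilizer_ne_top q, fun K hK => ?_⟩
  obtain ⟨k, hk, hkq⟩ : ∃ k ∈ K, q < k q := by
    obtain ⟨k, hk, hkq⟩ := SetLike.exists_of_lt hK
    rcases lt_or_gt_of_ne (show k q ≠ q from hkq) with h | h
    · exact ⟨k⁻¹, K.inv_mem hk, by simpa using k⁻¹.strictMono h⟩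
    · exact ⟨k, hk, h⟩
  have key : ∀ g : ℚ ≃o ℚ, q < g q → g ∈ K := fun g hg => by
    obtain ⟨s, hs, hsk⟩ := OrderIso.exists_apply_eq_apply_eq hkq hg
    have hs' : s ∈ K := hK.le hs
    have hfix : (s * k)⁻¹ * g ∈ K := hK.le (by
      change ((s * k)⁻¹ * g) q = q
      rw [RelIso.mul_apply, ← hsk, ← RelIso.mul_apply s k, RelIso.inv_apply_self])
    exact (K.mul_mem_cancel_left (K.inv_mem (K.mul_mem hs' hk))).1 hfix
  refine (Subgroup.eq_top_iff' K).2 fun g => ?_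
  rcases lt_trichotomy (g q) q with h | h | h
  · exact inv_mem_iff.1 (key g⁻¹ (by simpa using g⁻¹.strictMono h))
  · exact hK.le h
  · exact key g h

/-! ### Proper open subgroups fix a point -/

/-- If `H` contains the pointwise stabilizer of `F`, and some `h ∈ H` satisfies `q ∉ h F`, then `H`
contains the pointwise stabilizer of `F \ {q}`. The reason is that `H` also contains the pointwise
stabilizer of `h F`, which moves `q` freely in a small interval. -/
theorem fixingSubgroup_erase_le {H : Subgroup (ℚ ≃o ℚ)} {F : Finset ℚ}
    (hF : fixingSubgroup (ℚ ≃o ℚ) (F : Set ℚ) ≤ H) {q : ℚ} {h : ℚ ≃o ℚ} (hh : h ∈ H)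
    (hqh : q ∉ F.image h) : fixingSubgroup (ℚ ≃o ℚ) (F.erase q : Set ℚ) ≤ H := by
  have hF' : fixingSubgroup (ℚ ≃o ℚ) (F.image h : Set ℚ) ≤ H := fun g hg => by
    have hc : h⁻¹ * g * h ∈ H := hF <| (mem_fixingSubgroup_iff _).2 fun p hp => by
      have : g (h p) = h p :=
        (mem_fixingSubgroup_iff _).1 hg (h p) (Finset.mem_coe.2 (Finset.mem_image_of_mem h hp))
      simp [mul_smul, this]
    simpa [mul_assoc] using H.mul_mem (H.mul_mem hh hc) (H.inv_mem hh)
  have avoid : ∀ (E : Finset ℚ) (r : ℚ), r ∉ E →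
      ∃ c d, r ∈ Set.Ioo c d ∧ ∀ p ∈ E, p ∉ Set.Ioo c d :=
    fun E r hr => by
      obtain ⟨c, d, hr, hcd⟩ := mem_nhds_iff_exists_Ioo_subset.1
        (E.finite_toSet.isClosed.isOpen_compl.mem_nhds (show r ∈ (E : Set ℚ)ᶜ from hr))
      exact ⟨c, d, hr, fun p hp hp' => hcd hp' hp⟩
  have up : ∀ g ∈ fixingSubgroup (ℚ ≃o ℚ) (F.erase q : Set ℚ), q < g q → g ∈ H := by
    intro g hg hqg
    have hgp : ∀ p ∈ F, p ≠ q → g p = p := fun p hp hpq =>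
      (mem_fixingSubgroup_iff _).1 hg p (Finset.mem_coe.2 (Finset.mem_erase.2 ⟨hpq, hp⟩))
    obtain ⟨c, d, ⟨hcq, hqd⟩, hcd⟩ := avoid (F.erase q ∪ F.image h) q
      (by simpa using hqh)
    obtain ⟨m, hqm, hmd⟩ := exists_between hqd
    obtain ⟨a, b, ⟨hag, hgb⟩, hab⟩ := avoid (F.erase q) (g q) fun hmem => by
      have := hgp _ (Finset.mem_of_mem_erase hmem) (Finset.ne_of_mem_erase hmem)
      exact Finset.ne_of_mem_erase hmem (g.injective this)
    -- `f` fixes `F` and brings `g q` close to `q`; then `k`, which fixes `h F`, brings it to `q`.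
    obtain ⟨f, hfm, hf⟩ := OrderIso.exists_apply_eq_of_Ioo (a := q) (b := max b d) (x := g q)
      (y := m) ⟨hqg, hgb.trans_le (le_max_left _ _)⟩ ⟨hqm, hmd.trans_le (le_max_right _ _)⟩
    have hfF : ∀ p ∈ F, f p = p := fun p hp => hf p fun hpI => by
      have hpq : p ≠ q := hpI.1.ne'
      have hpE := Finset.mem_erase.2 ⟨hpq, hp⟩
      have hgqp : g q < p := (hgp p hp hpq) ▸ g.strictMono hpI.1
      rcases lt_max_iff.1 hpI.2 with h | h
      · exact hab p hpE ⟨hag.trans hgqp, h⟩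
      · exact hcd p (Finset.mem_union_left _ hpE) ⟨hcq.trans hpI.1, h⟩
    obtain ⟨k, hkq, hk⟩ := OrderIso.exists_apply_eq_of_Ioo (a := c) (b := d) (x := m) (y := q)
      ⟨hcq.trans hqm, hmd⟩ ⟨hcq, hqd⟩
    have hkH : k ∈ H := hF' <| (mem_fixingSubgroup_iff _).2 fun p hp =>
      hk p (hcd p (Finset.mem_union_right _ (Finset.mem_coe.1 hp)))
    have hkfg : k * (f * g) ∈ H := hF <| (mem_fixingSubgroup_iff _).2 fun p hp => by
      change k (f (g p)) = p
      by_cases hpq : p = q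
      · rw [hpq, hfm, hkq]
      · rw [hgp p hp hpq, hfF p hp]
        exact hk p (hcd p (Finset.mem_union_left _ (Finset.mem_erase.2 ⟨hpq, hp⟩)))
    exact (H.mul_mem_cancel_left (hF ((mem_fixingSubgroup_iff _).2 hfF))).1
      ((H.mul_mem_cancel_left hkH).1 hkfg)
  intro g hg
  rcases lt_trichotomy (g q) q with h | h | h
  · exact inv_mem_iff.1 (up g⁻¹ (inv_mem hg) (by simpa using g⁻¹.strictMono h))
  · refine hF ((mem_fixingSubgroup_iff _).2 fun p hp => ?_)
    by_cases hpq : p = q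
    · exact hpq ▸ h
    · exact (mem_fixingSubgroup_iff _).1 hg p (Finset.mem_coe.2 (Finset.mem_erase.2 ⟨hpq, hp⟩))
  · exact up g hg h

theorem exists_le_stabilizer_of_fixingSubgroup_le {H : Subgroup (ℚ ≃o ℚ)} (hH : H ≠ ⊤)
    (F : Finset ℚ) (hF : fixingSubgroup (ℚ ≃o ℚ) (F : Set ℚ) ≤ H) :
    ∃ p : ℚ, H ≤ stabilizer (ℚ ≃o ℚ) p := by
  induction F using Finset.strongInduction with
  | H F ih =>
    by_cases hmove : ∃ h ∈ H, ∃ q ∈ F, q ∉ F.image h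
    · obtain ⟨h, hh, q, hq, hqh⟩ := hmove
      exact ih _ (Finset.erase_ssubset hq) (fixingSubgroup_erase_le hF hh hqh)
    · push Not at hmove
      have hne : F.Nonempty := by
        rw [Finset.nonempty_iff_ne_empty]
        rintro rfl
        exact hH (top_le_iff.1 fun g _ => hF ((mem_fixingSubgroup_iff _).2 (by simp)))
      have hle : ∀ h ∈ H, h (F.min' hne) ≤ F.min' hne := fun h hh => by
        obtain ⟨p, hp, hpq⟩ := Finset.mem_image.1 (hmove h hh _ (F.min'_mem hne))
        exact (h.monotone (F.min'_le p hp)).trans_eq hpq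
      refine ⟨F.min' hne, fun h hh => le_antisymm (hle h hh) ?_⟩
      simpa using h.monotone (hle h⁻¹ (H.inv_mem hh))

/-! ### Point stabilizers as products of centralizers -/

theorem fixingSubgroup_Ici_le_centralizer (q : ℚ) :
    fixingSubgroup (ℚ ≃o ℚ) (Set.Ici q) ≤
      Subgroup.centralizer (fixingSubgroup (ℚ ≃o ℚ) (Set.Iic q)) := by
  intro g hg
  refine Subgroup.mem_centralizer_iff.2 fun h hh => ?_
  replace hg : ∀ x, q ≤ x → g x = x := (mem_fixingSubgroup_iff _).1 hg
  replace hh : ∀ x, x ≤ q → h x = x := (mem_fixingSubgroup_iff _).1 hh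
  ext x
  rw [RelIso.mul_apply, RelIso.mul_apply]
  rcases le_total x q with hx | hx
  · rw [hh x hx, hh (g x) ((g.monotone hx).trans_eq (hg q le_rfl))]
  · rw [hg x hx, hg (h x) ((hh q le_rfl).symm.trans_le (h.monotone hx))]

theorem centralizer_fixingSubgroup_Iic_le (q : ℚ) :
    Subgroup.centralizer (fixingSubgroup (ℚ ≃o ℚ) (Set.Iic q)) ≤ stabilizer (ℚ ≃o ℚ) q := by
  have key : ∀ g ∈ Subgroup.centralizer (fixingSubgroup (ℚ ≃o ℚ) (Set.Iic q) : Set (ℚ ≃o ℚ)),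
      g q ≤ q := fun g hg => by
    by_contra! hlt
    obtain ⟨r, hr, hfix⟩ := OrderIso.exists_apply_ne (a := q) (b := g q + 1) ⟨hlt, lt_add_one _⟩
    have hr' : ∀ x ≤ q, r x = x := fun x hx => hfix x fun h => h.1.not_ge hx
    have := DFunLike.congr_fun
      (Subgroup.mem_centralizer_iff.1 hg r ((mem_fixingSubgroup_iff _).2 hr')) q
    rw [RelIso.mul_apply, RelIso.mul_apply, hr' q le_rfl] at this
    exact hr this
  refine fun g hg => le_antisymm (key g hg) ?_
  simpa using g.monotone (key g⁻¹ (inv_mem hg))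

theorem centralizer_fixingSubgroup_Ici_le (q : ℚ) :
    Subgroup.centralizer (fixingSubgroup (ℚ ≃o ℚ) (Set.Ici q)) ≤ stabilizer (ℚ ≃o ℚ) q := by
  have key : ∀ g ∈ Subgroup.centralizer (fixingSubgroup (ℚ ≃o ℚ) (Set.Ici q) : Set (ℚ ≃o ℚ)),
      q ≤ g q := fun g hg => by
    by_contra! hlt
    obtain ⟨r, hr, hfix⟩ := OrderIso.exists_apply_ne (a := g q - 1) (b := q) ⟨sub_one_lt _, hlt⟩
    have hr' : ∀ x, q ≤ x → r x = x := fun x hx => hfix x fun h => h.2.not_ge hx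
    have := DFunLike.congr_fun
      (Subgroup.mem_centralizer_iff.1 hg r ((mem_fixingSubgroup_iff _).2 hr')) q
    rw [RelIso.mul_apply, RelIso.mul_apply, hr' q le_rfl] at this
    exact hr this
  refine fun g hg => le_antisymm ?_ (key g hg)
  simpa using g.monotone (key g⁻¹ (inv_mem hg))

theorem disjoint_centralizer_fixingSubgroup (q : ℚ) :
    Disjoint (Subgroup.centralizer (fixingSubgroup (ℚ ≃o ℚ) (Set.Ici q) : Set (ℚ ≃o ℚ)))
      (Subgroup.centralizer (fixingSubgroup (ℚ ≃o ℚ) (Set.Iic q))) := by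
  have key : ∀ k ∈ Subgroup.centralizer (fixingSubgroup (ℚ ≃o ℚ) (Set.Ici q) : Set (ℚ ≃o ℚ)),
      k ∈ Subgroup.centralizer (fixingSubgroup (ℚ ≃o ℚ) (Set.Iic q) : Set (ℚ ≃o ℚ)) →
      ∀ x, k x ≤ x := fun k hL hR x => by
    have hkq : k q = q := centralizer_fixingSubgroup_Iic_le q hR
    by_contra! hlt
    -- Move `x` within an interval on one side of `q` that does not contain `k x`.
    obtain ⟨r, hr, hrk, hcomm⟩ : ∃ r : ℚ ≃o ℚ, r x ≠ x ∧ r (k x) = k x ∧ r * k = k * r := by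
      rcases lt_trichotomy x q with hx | rfl | hx
      · obtain ⟨r, hr, hfix⟩ := OrderIso.exists_apply_ne (a := x - 1) (b := min (k x) q)
          ⟨sub_one_lt x, lt_min hlt hx⟩
        refine ⟨r, hr, hfix _ fun h => (h.2.trans_le (min_le_left _ _)).false, ?_⟩
        exact Subgroup.mem_centralizer_iff.1 hL r ((mem_fixingSubgroup_iff _).2 fun y hy =>
          hfix y fun h => (h.2.trans_le (min_le_right _ _)).not_ge hy)
      · exact absurd hkq hlt.ne'
      · obtain ⟨r, hr, hfix⟩ := OrderIso.exists_apply_ne (a := q) (b := k x) ⟨hx, hlt⟩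
        refine ⟨r, hr, hfix _ fun h => h.2.false, ?_⟩
        exact Subgroup.mem_centralizer_iff.1 hR r ((mem_fixingSubgroup_iff _).2 fun y hy =>
          hfix y fun h => h.1.not_ge hy)
    have := DFunLike.congr_fun hcomm x
    rw [RelIso.mul_apply, RelIso.mul_apply, hrk] at this
    exact hr (k.injective this).symm
  refine Subgroup.disjoint_def.2 fun {k} hL hR => ?_
  ext x
  refine le_antisymm (key k hL hR x) ?_
  simpa using k.monotone (key k⁻¹ (inv_mem hL) (inv_mem hR) x)

theorem coe_stabilizer_eq_mul (q : ℚ) : (stabilizer (ℚ ≃o ℚ) q : Set (ℚ ≃o ℚ)) =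
    ((Subgroup.centralizer (fixingSubgroup (ℚ ≃o ℚ) (Set.Ici q) : Set (ℚ ≃o ℚ)) :
        Subgroup (ℚ ≃o ℚ)) : Set (ℚ ≃o ℚ)) *
      (Subgroup.centralizer (fixingSubgroup (ℚ ≃o ℚ) (Set.Iic q) : Set (ℚ ≃o ℚ)) :
        Subgroup (ℚ ≃o ℚ)) := by
  refine Set.Subset.antisymm (fun g hg => ?_) ?_
  · replace hg : g q = q := hg
    refine Set.mem_mul.2 ⟨g * (g.restrictIic hg)⁻¹, ?_, g.restrictIic hg, ?_, by simp⟩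
    · refine Subgroup.le_centralizer_iff.1 (fixingSubgroup_Ici_le_centralizer q)
        ((mem_fixingSubgroup_iff _).2 fun x hx => ?_)
      have hle : (g.restrictIic hg)⁻¹ x ≤ q := by
        have h1 : g.restrictIic hg q = q := by simp [OrderIso.restrictIic_apply, hg]
        rw [← (g.restrictIic hg).le_iff_le, RelIso.apply_inv_self, h1]
        exact hx
      have h2 := RelIso.apply_inv_self (g.restrictIic hg) x
      rw [OrderIso.restrictIic_apply, if_pos hle] at h2
      exact h2
    · refine fixingSubgroup_Ici_le_centralizer q ((mem_fixingSubgroup_iff _).2 fun x hx => ?_)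
      change g.restrictIic hg x = x
      rw [OrderIso.restrictIic_apply]
      split_ifs with h
      · rw [le_antisymm h hx, hg]
      · rfl
  · rintro _ ⟨a, ha, b, hb, rfl⟩
    exact mul_mem (centralizer_fixingSubgroup_Ici_le q ha) (centralizer_fixingSubgroup_Iic_le q hb)

/-! ### Automorphisms permute the point stabilizers -/

theorem isClosed_comap_centralizer {G : Type*} [Group G] [TopologicalSpace G] [ContinuousMul G]
    [T2Space G] (ψ : MulAut G) (S : Set G) :
    IsClosed ((Subgroup.centralizer S).comap ψ.toMonoidHom : Set G) := by
  convert Set.isClosed_centralizer (ψ ⁻¹' S) using 1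
  ext x
  simp only [Subgroup.coe_comap, Set.mem_preimage, SetLike.mem_coe, Subgroup.mem_centralizer_iff,
    Set.mem_centralizer_iff]
  refine ⟨fun h m hm => ψ.injective (by simpa using h (ψ m) hm), fun h m hm => ?_⟩
  have := congrArg ψ (h (ψ.symm m) (by simpa using hm))
  simpa using this

theorem isOpen_comap_stabilizer (ψ : MulAut (ℚ ≃o ℚ)) (q : ℚ) :
    IsOpen ((stabilizer (ℚ ≃o ℚ) q).comap ψ.toMonoidHom : Set (ℚ ≃o ℚ)) := by
  have : Countable ((ℚ ≃o ℚ) ⧸ (stabilizer (ℚ ≃o ℚ) q).comap ψ.toMonoidHom) := by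
    refine Function.Injective.countable (f := fun c => ψ c.out q) fun c d hcd => ?_
    rw [← QuotientGroup.out_eq' c, ← QuotientGroup.out_eq' d]
    refine QuotientGroup.eq.2 ?_
    replace hcd : ψ c.out q = ψ d.out q := hcd
    change ψ (c.out⁻¹ * d.out) q = q
    rw [map_mul, map_inv, RelIso.mul_apply, ← hcd, RelIso.inv_apply_self]
  refine Subgroup.isOpen_of_eq_mul_of_isClosed
    (isClosed_comap_centralizer ψ (fixingSubgroup (ℚ ≃o ℚ) (Set.Ici q)))
    (isClosed_comap_centralizer ψ (fixingSubgroup (ℚ ≃o ℚ) (Set.Iic q))) ?_ ?_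
  · refine Subgroup.disjoint_def.2 fun {k} hL hR => ψ.injective ?_
    rw [map_one]
    exact Subgroup.disjoint_def.1 (disjoint_centralizer_fixingSubgroup q) hL hR
  · ext g
    change ψ g ∈ (stabilizer (ℚ ≃o ℚ) q : Set (ℚ ≃o ℚ)) ↔ _
    rw [coe_stabilizer_eq_mul, Set.mem_mul, Set.mem_mul]
    constructor
    · rintro ⟨a, ha, b, hb, hab⟩
      exact ⟨ψ.symm a, by simpa using ha, ψ.symm b, by simpa using hb, ψ.injective (by simp [hab])⟩
    · rintro ⟨a, ha, b, hb, rfl⟩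
      exact ⟨ψ a, ha, ψ b, hb, (map_mul ψ a b).symm⟩

/-- The preimage of a point stabilizer under an automorphism of `Aut(ℚ)` is a point stabilizer. -/
theorem exists_comap_stabilizer_eq (ψ : MulAut (ℚ ≃o ℚ)) (q : ℚ) :
    ∃ p : ℚ, ∀ g : ℚ ≃o ℚ, ψ g q = q ↔ g p = p := by
  have hne : (stabilizer (ℚ ≃o ℚ) q).comap ψ.toMonoidHom ≠ ⊤ := fun h =>
    stabilizer_ne_top q <| (Subgroup.eq_top_iff' _).2 fun g => by
      have : ψ.symm g ∈ (stabilizer (ℚ ≃o ℚ) q).comap ψ.toMonoidHom := h ▸ Subgroup.mem_top _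
      simpa using this
  obtain ⟨F, hF⟩ := exists_finset_fixing_subset_of_mem_nhds
    ((isOpen_comap_stabilizer ψ q).mem_nhds (one_mem _))
  obtain ⟨p, hp⟩ := exists_le_stabilizer_of_fixingSubgroup_le hne F
    fun g hg => hF g ((mem_fixingSubgroup_iff _).1 hg)
  -- The inclusion of the preimage in the stabilizer of `p` turns into an equality
  -- because the stabilizer of `q` is maximal.
  have hle : stabilizer (ℚ ≃o ℚ) q ≤ (stabilizer (ℚ ≃o ℚ) p).comap ψ.symm.toMonoidHom :=
    fun g hg => hp (show ψ (ψ.symm g) q = q by simpa using hg)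
  have hne' : (stabilizer (ℚ ≃o ℚ) p).comap ψ.symm.toMonoidHom ≠ ⊤ := fun h =>
    stabilizer_ne_top p <| (Subgroup.eq_top_iff' _).2 fun g => by
      have : ψ g ∈ (stabilizer (ℚ ≃o ℚ) p).comap ψ.symm.toMonoidHom := h ▸ Subgroup.mem_top _
      simpa using this
  have heq := ((isCoatom_stabilizer q).le_iff.1 hle).resolve_left hne'
  refine ⟨p, fun g => ⟨fun h => hp h, fun h => ?_⟩⟩
  have : ψ g ∈ (stabilizer (ℚ ≃o ℚ) p).comap ψ.symm.toMonoidHom :=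
    show ψ.symm (ψ g) p = p by simpa using h
  rw [heq] at this
  exact this

/-! ### Automorphisms are induced by permutations of `ℚ` -/

theorem exists_perm_conj (φ : MulAut (ℚ ≃o ℚ)) :
    ∃ σ : Equiv.Perm ℚ, ∀ (g : ℚ ≃o ℚ) (q : ℚ), φ g (σ q) = σ (g q) := by
  choose τ hτ using exists_comap_stabilizer_eq φ
  choose σ hσ using exists_comap_stabilizer_eq φ.symm
  have hσ' : ∀ q g, φ g (σ q) = σ q ↔ g q = q := fun q g => by simpa using (hσ q (φ g)).symm
  have hστ : ∀ q, σ (τ q) = q := fun q => eq_of_stabilizer_le fun g (hg : g _ = _) => by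
    obtain ⟨g, rfl⟩ := φ.surjective g
    exact (hτ q g).2 ((hσ' _ g).1 hg)
  have hτσ : ∀ q, τ (σ q) = q := fun q => eq_of_stabilizer_le fun g (hg : g _ = _) =>
    (hσ' q g).1 ((hτ _ g).2 hg)
  refine ⟨⟨σ, τ, hτσ, hστ⟩, fun h q => eq_of_stabilizer_le fun g (hg : g _ = _) => ?_⟩
  obtain ⟨g, rfl⟩ := φ.surjective g
  change φ g (σ (h q)) = σ (h q)
  change φ g (φ h (σ q)) = φ h (σ q) at hg
  rw [hσ']
  have : φ (h⁻¹ * g * h) (σ q) = σ q := by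
    simp only [map_mul, map_inv, RelIso.mul_apply, hg, RelIso.inv_apply_self]
  rw [hσ'] at this
  simpa only [RelIso.mul_apply, RelIso.apply_inv_self] using congrArg h this

theorem strictMono_or_strictAnti_of_conj {φ : MulAut (ℚ ≃o ℚ)} {σ : Equiv.Perm ℚ}
    (h : ∀ (g : ℚ ≃o ℚ) (q : ℚ), φ g (σ q) = σ (g q)) : StrictMono σ ∨ StrictAnti σ := by
  rcases lt_or_gt_of_ne (σ.injective.ne (zero_ne_one (α := ℚ))) with h01 | h01
  · refine .inl fun x y hxy => ?_
    obtain ⟨g, rfl, rfl⟩ := OrderIso.exists_apply_eq_apply_eq zero_lt_one hxy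
    simpa only [← h] using (φ g).strictMono h01
  · refine .inr fun x y hxy => ?_
    obtain ⟨g, rfl, rfl⟩ := OrderIso.exists_apply_eq_apply_eq zero_lt_one hxy
    simpa only [← h] using (φ g).strictMono h01

theorem exists_eq_conj_or_eq_conj_mul_negConj (φ : MulAut (ℚ ≃o ℚ)) :
    ∃ g : ℚ ≃o ℚ, φ = MulAut.conj g ∨ φ = MulAut.conj g * negConj := by
  obtain ⟨σ, hσ⟩ := exists_perm_conj φ
  rcases strictMono_or_strictAnti_of_conj hσ with hm | hm
  · let s := hm.orderIsoOfRightInverse σ σ.symm σ.apply_symm_apply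
    refine ⟨s, .inl ?_⟩
    ext h q
    change φ h q = σ (h (σ.symm q))
    rw [← hσ, σ.apply_symm_apply]
  · let s := StrictMono.orderIsoOfRightInverse (fun q => σ (-q))
      (fun x y hxy => hm (neg_lt_neg hxy)) (fun q => -σ.symm q) (fun q => by simp)
    refine ⟨s, .inr ?_⟩
    ext h q
    change φ h q = σ (- -(h (- -σ.symm q)))
    rw [neg_neg, neg_neg, ← hσ, σ.apply_symm_apply]

theorem mulAut_conj_orderIso_injective : Function.Injective (MulAut.conj (G := ℚ ≃o ℚ)) := by
  refine (injective_iff_map_eq_one _).2 fun g hg => ?_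
  ext q
  refine (eq_of_stabilizer_le fun h (hh : h q = q) => ?_).symm
  have : g * h * g⁻¹ = h := DFunLike.congr_fun hg h
  rw [mul_inv_eq_iff_eq_mul] at this
  change h (g q) = g q
  rw [← RelIso.mul_apply, ← this, RelIso.mul_apply, hh]

theorem conj_mul_negConj_ne_one (g : ℚ ≃o ℚ) : MulAut.conj g * negConj ≠ 1 := fun h => by
  -- Otherwise the order-reversing map `q ↦ g (-q)` would commute with `q ↦ q + 1`.
  have h1 := DFunLike.congr_fun (DFunLike.congr_fun h (OrderIso.addRight 1)) (g 0)
  change g (-((-g.symm (g 0)) + 1)) = g 0 + 1 at h1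
  rw [OrderIso.symm_apply_apply] at h1
  have h2 : g (-(-0 + 1)) < g 0 := g.strictMono (by norm_num)
  linarith

theorem corollary1p6 :
    ∃ e : ((ℚ ≃o ℚ) ⋊[negAction] Multiplicative (ZMod 2)) ≃* MulAut (ℚ ≃o ℚ),
      (∀ g : ℚ ≃o ℚ, e (SemidirectProduct.inl g) = MulAut.conj g) ∧
      e (SemidirectProduct.inr (Multiplicative.ofAdd 1)) = negConj := by
  have hone : negAction (Multiplicative.ofAdd 1) = negConj := by
    change (if Multiplicative.ofAdd (1 : ZMod 2) = 1 then 1 else negConj) = negConj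
    exact if_neg (by decide)
  have htwo : ∀ z : Multiplicative (ZMod 2), z = 1 ∨ z = Multiplicative.ofAdd 1 := by decide
  let f : ((ℚ ≃o ℚ) ⋊[negAction] Multiplicative (ZMod 2)) →* MulAut (ℚ ≃o ℚ) :=
    SemidirectProduct.lift MulAut.conj negAction fun z => by
      ext g h q
      simp [MulAut.conj_apply]
  have hf : ∀ x, f x = MulAut.conj x.left * negAction x.right := fun x => rfl
  have hbij : Function.Bijective f := by
    refine ⟨(injective_iff_map_eq_one f).2 fun x hx => ?_, fun φ => ?_⟩
    · rw [hf] at hx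
      rcases htwo x.right with hr | hr
      · rw [hr, map_one, mul_one, ← map_one MulAut.conj] at hx
        exact SemidirectProduct.ext (mulAut_conj_orderIso_injective hx) hr
      · rw [hr, hone] at hx
        exact absurd hx (conj_mul_negConj_ne_one _)
    · obtain ⟨g, rfl | rfl⟩ := exists_eq_conj_or_eq_conj_mul_negConj φ
      · exact ⟨SemidirectProduct.inl g, SemidirectProduct.lift_inl _ _ _ g⟩
      · exact ⟨⟨g, Multiplicative.ofAdd 1⟩, by rw [hf, hone]⟩
  refine ⟨MulEquiv.ofBijective f hbij, fun g => ?_, ?_⟩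
  · simp [hf]
  · simp [hf, hone]
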